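/- For $x>0$ let $\mathrm{slog}(x)=\log(x+1/x)$. For a set $X$ let $L^\infty(X)$ be the Banach space of bounded real functions on $X$ with the supremum norm. A subset $Z$ of a normed space is called $(\alpha,\beta)$-almost homogeneous at $0$ if there are constants $M,s>0$ such that for all $0<\rho<r$ the set $\{z\in Z:\|z\|\le r\}$ can be covered by at most $$M\left(\frac r\rho\right)^{s}\mathrm{slog}(r)^{\alpha}\,\mathrm{slog}(\rho)^{\beta}$$ closed balls of radius $\rho$ with centres in $Z$. Theorem. Let $(X,d)$ be a metric space, let $\alpha,\beta\ge 0$, and let $\Phi(x)=d(x,\cdot)$, $x\in X$, be the Kuratowski embedding. Suppose that $$\Phi(X)-\Phi(X)=\{\,d(x,\cdot)-d(y,\cdot):x,y\in X\,\}\subset L^\infty(X)$$ is $(\alpha,\beta)$-almost homogeneous at $0$ (these differences are bounded functions for every metric space $X$). Then for every $\delta>1+\frac{\alpha+\beta}{2}$ there exist $N\in\mathbb{N}$ and an injective map $L\colon X\to\mathbb{R}^N$ that is bi-Lipschitz with $\delta$-logarithmic corrections, that is, there is a constant $C>0$ such that for all $x\ne y$ in $X$ $$\frac1C\,\frac{d(x,y)}{\mathrm{slog}(d(x,y))^{\delta}}\le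 |L(x)-L(y)|\le C\,d(x,y),$$ where $|\cdot|$ is the Euclidean norm. -/

import Mathlib

open scoped ENNReal

noncomputable section

/-- The symmetric logarithm `slog x = log (x + 1 / x)`, used for `x > 0`, where it is at least
`log 2`. -/
def slog (x : ℝ) : ℝ := Real.log (x + 1 / x)

/-- A set `Z` in a normed space is `(α, β)`-almost `(M, s)`-homogeneous at the origin: for all
`0 < ρ < r`, the part of `Z` in the ball of radius `r` about `0` is covered by at most
`M (r / ρ) ^ s (slog r) ^ α (slog ρ) ^ β` balls of radius `ρ` with centres in `Z`. -/
def AlmostHomogeneousAtZeroWith {E : Type*} [NormedAddCommGroup E]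
    (α β M s : ℝ) (Z : Set E) : Prop :=
  ∀ r ρ : ℝ, 0 < ρ → ρ < r →
    ∃ t : Finset E, (t : Set E) ⊆ Z ∧
      Metric.closedBall (0 : E) r ∩ Z ⊆ ⋃ z ∈ t, Metric.closedBall z ρ ∧
      (t.card : ℝ) ≤ M * (r / ρ) ^ s * slog r ^ α * slog ρ ^ β

/-- `(α, β)`-almost homogeneity at the origin: the above for some constants `M, s > 0`. -/
def AlmostHomogeneousAtZero {E : Type*} [NormedAddCommGroup E]
    (α β : ℝ) (Z : Set E) : Prop :=
  ∃ M s : ℝ, 0 < M ∧ 0 < s ∧ AlmostHomogeneousAtZeroWith α β M s Z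

/-- `L^∞(X)`: the Banach space of all bounded real functions on `X` with the supremum norm. -/
abbrev LInfty (X : Type*) : Type _ := lp (fun _ : X => ℝ) ∞

/-- The Kuratowski map `Φ(x) = d(x, ·)`. The function `Φ(x)` itself is bounded when `X` is, while
the differences `Φ(x) - Φ(y)` are bounded for every metric space `X`. -/
def kuratowskiMap {X : Type*} [MetricSpace X] (x : X) : X → ℝ := fun z => dist x z

/-- The set of differences `Φ(X) - Φ(X)`, as a subset of `L^∞(X)`. -/
def kuratowskiDiff (X : Type*) [MetricSpace X] : Set (LInfty X) :=
  {f | ∃ x y : X, (f : X → ℝ) = kuratowskiMap x - kuratowskiMap y}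

/-- Every difference `Φ(x) - Φ(y)` lies in `L^∞(X)`, and its norm is `d(x, y)`. -/
theorem kuratowskiMap_sub_mem {X : Type*} [MetricSpace X] (x y : X) :
    ∃ f ∈ kuratowskiDiff X, (f : X → ℝ) = kuratowskiMap x - kuratowskiMap y ∧
      ‖f‖ = dist x y := by
  have hle : ∀ z, ‖(kuratowskiMap x - kuratowskiMap y) z‖ ≤ dist x y := fun z => by
    simpa [kuratowskiMap, Real.norm_eq_abs] using abs_dist_sub_le x y z
  have hmem : Memℓp (E := fun _ : X => ℝ) (kuratowskiMap x - kuratowskiMap y) ∞ :=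
    memℓp_infty ⟨dist x y, by rintro _ ⟨z, rfl⟩; exact hle z⟩
  refine ⟨⟨_, hmem⟩, ⟨x, y, rfl⟩, rfl, le_antisymm ?_ ?_⟩
  · exact lp.norm_le_of_forall_le dist_nonneg hle
  · have h := lp.norm_apply_le_norm ENNReal.top_ne_zero
      (⟨_, hmem⟩ : LInfty X) y
    have h2 : ‖(kuratowskiMap x - kuratowskiMap y) y‖ = dist x y := by
      simp [kuratowskiMap]
    exact h2 ▸ h

/-- A map between metric spaces is bi-Lipschitz with `δ`-logarithmic corrections
(`δ`-almost bi-Lipschitz). -/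
def BiLipschitzWithLogCorrection {X Y : Type*} [MetricSpace X] [MetricSpace Y]
    (δ : ℝ) (L : X → Y) : Prop :=
  ∃ C : ℝ, 0 < C ∧ ∀ x y : X, x ≠ y →
    1 / C * (dist x y / slog (dist x y) ^ δ) ≤ dist (L x) (L y) ∧
      dist (L x) (L y) ≤ C * dist x y

end

-- The Kuratowski map is isometric, so the hypothesis bounds separated sets in balls of `X`: at
-- bounded scale ratio they have `O(slog ^ (α + β))` points. This packing form passes to subspaces,
-- so it suffices to embed finite subsets with uniform constants
-- (`exists_uniform_embedding_of_finite`) and take an ultrafilter limit.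
--
-- For a finite space use scales `r i`, `i ∈ ℤ`, with ratios `g i ^ (-η)` where `g i = A + |i|`; up
-- to small powers, `g i` is `slog (r i)`. Each scale adds a perturbation with Lipschitz constant `g
-- ^ (-(1 + η))`. Summability of these constants costs the `1` in `δ`. The perturbation combines
-- bumps with digit vectors as coefficients, so its amplitude is divided by the number `m` of bumps
-- active at a point. A plain net would give `m ≈ g ^ (α + β)`; splitting the net into light and
-- heavy points (`exists_bumps`) gives the square root, hence the cost `(α + β) / 2`.
--
-- The local lemma `exists_forall_not_bad` chooses digits separating all relevant pairs whatever the
-- earlier perturbations were, in a number of coordinates independent of the scale. Scales in one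
-- residue class mod `G` are so far apart that finer perturbations cannot undo coarser ones
-- (`exists_sum_perturbations`); different classes get different coordinates.

universe u

/-! ### A local lemma proved by counting. -/

/-- A local lemma: if every constraint `e` owns a variable of its support at which at most one label
is bad whatever the other labels are, and every variable meets at most `Δ` supports with
`4 * Δ ≤ |Q|`, then some assignment satisfies all constraints. -/
theorem exists_forall_not_bad {V Q E : Type*} [Fintype V] [DecidableEq V] [Fintype Q] [Nonempty Q]
    [Fintype E] (supp : E → Finset V) (own : E → V) (bad : E → (V → Q) → Prop)
    (hown : ∀ e, own e ∈ supp e)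
    (hdep : ∀ e f f', (∀ v ∈ supp e, f v = f' v) → bad e f → bad e f')
    (huniq : ∀ e f a a', bad e (Function.update f (own e) a) →
      bad e (Function.update f (own e) a') → a = a')
    (Δ : ℕ) (hΔ : ∀ v, {e | v ∈ supp e}.ncard ≤ Δ) (hQ : 4 * Δ ≤ Fintype.card Q) :
    ∃ f, ∀ e, ¬ bad e f := by
  classical
  let C : Finset V → Finset (V → Q) := fun S =>
    Finset.univ.filter fun f => ∀ e, supp e ⊆ S → ¬ bad e f
  have hCmem : ∀ S f, f ∈ C S ↔ ∀ e, supp e ⊆ S → ¬ bad e f := fun S f => by simp [C]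
  -- Admitting one more variable at most halves the number of assignments that satisfy all
  -- constraints supported in the set.
  have key : ∀ n : ℕ, ∀ S : Finset V, S.card = n → ∀ v, v ∉ S →
      (C S).card ≤ 2 * (C (insert v S)).card := by
    intro n
    induction n using Nat.strong_induction_on with
    | _ n ih =>
      intro S hS v hv
      let D : E → Finset (V → Q) := fun e => (C S).filter fun f => bad e f
      let Ev : Finset E := Finset.univ.filter fun e => v ∈ supp e
      have hEv : Ev.card ≤ Δ := by
        have := hΔ v
        rwa [Set.ncard_eq_toFinset_card', Set.toFinset_ofPred] at this
      have hsub : C S ⊆ C (insert v S) ∪ Ev.biUnion D := by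
        intro f hf
        by_cases hfv : f ∈ C (insert v S)
        · exact Finset.mem_union_left _ hfv
        · rw [hCmem] at hfv
          push Not at hfv
          obtain ⟨e, he, hb⟩ := hfv
          refine Finset.mem_union_right _ (Finset.mem_biUnion.2 ⟨e, ?_, ?_⟩)
          · simp only [Ev, Finset.mem_filter, Finset.mem_univ, true_and]
            by_contra hve
            refine (hCmem S f).1 hf e (fun w hw => ?_) hb
            rcases Finset.mem_insert.1 (he hw) with h | h
            · exact absurd (h ▸ hw) hve
            · exact h
          · exact Finset.mem_filter.2 ⟨hf, hb⟩
      have hD : ∀ e, Fintype.card Q * (D e).card ≤ 2 * (C S).card := by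
        intro e
        -- Resample the owned variable. Constraints avoiding it stay satisfied, and by `huniq` its
        -- old value can be recovered from the others, so the map is injective.
        have h1 : (D e ×ˢ (Finset.univ : Finset Q)).card ≤ (C (S.erase (own e))).card := by
          refine Finset.card_le_card_of_injOn (fun x => Function.update x.1 (own e) x.2) ?_ ?_
          · rintro ⟨f, a⟩ hfa
            have hf : f ∈ D e := (Finset.mem_product.1 hfa).1
            refine (hCmem _ _).2 fun e' he' hb => ?_
            refine (hCmem S f).1 (Finset.mem_filter.1 hf).1 e'
              (he'.trans (Finset.erase_subset _ _)) (hdep e' _ _ (fun w hw => ?_) hb)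
            exact Function.update_of_ne (Finset.ne_of_mem_erase (he' hw)) _ _
          · rintro ⟨f, a⟩ hf ⟨f', a'⟩ hf' h
            have hf1 := (Finset.mem_filter.1 (Finset.mem_product.1 hf).1).2
            have hf2 := (Finset.mem_filter.1 (Finset.mem_product.1 hf').1).2
            simp only at h hf1 hf2
            have ha : a = a' := by simpa using congrFun h (own e)
            have hoff : ∀ w, w ≠ own e → f w = f' w := fun w hw => by
              simpa [hw] using congrFun h w
            have hu : f' = Function.update f (own e) (f' (own e)) := by
              ext1 w
              by_cases hw : w = own e
              · subst hw; simp
              · simp [hw, hoff w hw]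
            have hfo : f (own e) = f' (own e) := by
              refine huniq e f _ _ ?_ (hu ▸ hf2)
              simpa using hf1
            have : f = f' := by
              ext1 w
              by_cases hw : w = own e
              · rw [hw, hfo]
              · exact hoff w hw
            rw [this, ha]
        have h2 : (C (S.erase (own e))).card ≤ 2 * (C S).card := by
          by_cases hu : own e ∈ S
          · have := ih _ (hS ▸ Finset.card_erase_lt_of_mem hu) (S.erase (own e)) rfl (own e)
              (Finset.notMem_erase _ _)
            rwa [Finset.insert_erase hu] at this
          · rw [Finset.erase_eq_of_notMem hu]; omega
        rw [Finset.card_product, Finset.card_univ, mul_comm] at h1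
        exact h1.trans h2
      have h3 : (C S).card ≤ (C (insert v S)).card + ∑ e ∈ Ev, (D e).card :=
        (Finset.card_le_card hsub).trans ((Finset.card_union_le _ _).trans
          (Nat.add_le_add_left Finset.card_biUnion_le _))
      have h4 : Fintype.card Q * ∑ e ∈ Ev, (D e).card ≤ Δ * (2 * (C S).card) := by
        rw [Finset.mul_sum]
        exact (Finset.sum_le_card_nsmul _ _ _ fun e _ => hD e).trans
          (Nat.mul_le_mul_right _ hEv)
      have hQ0 : 0 < Fintype.card Q := Fintype.card_pos
      -- At most `Δ ≤ |Q| / 4` constraints each spoil a fraction `2 / |Q|` of `C S`, so at least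
      -- half of it survives.
      have h5 : 2 * ∑ e ∈ Ev, (D e).card ≤ (C S).card := by
        refine Nat.le_of_mul_le_mul_left ?_ hQ0
        nlinarith [Nat.mul_le_mul_right (C S).card hQ]
      omega
  have hpos : ∀ S : Finset V, 0 < (C S).card := by
    intro S
    induction S using Finset.induction_on with
    | empty =>
      refine Finset.card_pos.2 ⟨fun _ => Classical.arbitrary Q, (hCmem _ _).2 fun e he => ?_⟩
      exact absurd (he (hown e)) (Finset.notMem_empty _)
    | insert v S hv ih =>
      have := key _ S rfl v hv
      omega
  obtain ⟨f, hf⟩ := Finset.card_pos.1 (hpos Finset.univ)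
  exact ⟨f, fun e => (hCmem _ _).1 hf e (Finset.subset_univ _)⟩

/-! ### Nets, and bumps with square-root multiplicity. -/

theorem exists_maximal_separated {Y : Type*} [MetricSpace Y] (W : Finset Y) {ε : ℝ} (hε : 0 < ε) :
    ∃ S ⊆ W, (∀ p ∈ S, ∀ q ∈ S, p ≠ q → ε ≤ dist p q) ∧ ∀ x ∈ W, ∃ p ∈ S, dist x p < ε := by
  classical
  let F := W.powerset.filter fun S => ∀ p ∈ S, ∀ q ∈ S, p ≠ q → ε ≤ dist p q
  obtain ⟨S, hS, hmax⟩ := F.exists_max_image Finset.card ⟨∅, by simp [F]⟩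
  obtain ⟨hSW, hsep⟩ := Finset.mem_filter.1 hS
  refine ⟨S, Finset.mem_powerset.1 hSW, hsep, fun x hx => ?_⟩
  by_contra! h
  have hxS : x ∉ S := fun hxS => by have := h x hxS; rw [dist_self] at this; linarith
  have : insert x S ∈ F := by
    refine Finset.mem_filter.2 ⟨Finset.mem_powerset.2
      (Finset.insert_subset hx (Finset.mem_powerset.1 hSW)), fun p hp q hq hpq => ?_⟩
    rcases Finset.mem_insert.1 hp with hpx | hpS <;> rcases Finset.mem_insert.1 hq with hqx | hqS
    · exact absurd (hpx.trans hqx.symm) hpq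
    · exact hpx ▸ h q hqS
    · rw [dist_comm]; exact hqx ▸ h p hpS
    · exact hsep p hpS q hqS hpq
  have := hmax _ this
  rw [Finset.card_insert_of_notMem hxS] at this
  omega

/-- If the `t / 4`-separated sets in balls of radius `5 t` have at most `m ^ 2` points, there are
`1`-Lipschitz bumps at scale `t` of which at most `2 m` are active at each point. -/
theorem exists_bumps {Y : Type*} [MetricSpace Y] [Fintype Y] {t m : ℝ} (ht : 0 < t) (hm : 0 < m)
    (hpack : ∀ (x : Y) (S : Finset Y), (∀ p ∈ S, dist p x ≤ 5 * t) →
      (∀ p ∈ S, ∀ q ∈ S, p ≠ q → t / 4 ≤ dist p q) → (S.card : ℝ) ≤ m ^ 2) :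
    ∃ b : Y ⊕ Y → Y → ℝ, (∀ p x, 0 ≤ b p x) ∧ (∀ p x y, |b p x - b p y| ≤ dist x y) ∧
      (∀ p x, b p x ≤ 4 * t) ∧ (∀ x, ({p | b p x ≠ 0}.ncard : ℝ) ≤ 2 * m) ∧
      (∀ p x y, b p x ≠ 0 → b p y ≠ 0 → dist x y ≤ 8 * t) ∧ ∀ x, ∃ p, t / 4 ≤ b p x := by
  classical
  obtain ⟨A, -, hAsep, hAnet⟩ := exists_maximal_separated (Finset.univ : Finset Y)
    (show 0 < t / 4 by positivity)
  let deg : Y → ℝ := fun p => ((A.filter fun a => dist a p ≤ t).card : ℝ)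
  -- Net points with at least `m` net points within `t` are heavy. The separation `9 t / 4 > 2 t`
  -- makes the `t`-balls about `B` disjoint, while bumps of radius `4 t` about `B` still reach
  -- everything near a heavy point.
  obtain ⟨B, hBH, hBsep, hBnet⟩ := exists_maximal_separated (A.filter fun p => m ≤ deg p)
    (show 0 < 9 * t / 4 by positivity)
  let AL := A.filter fun p => deg p < m
  let bump : Finset Y → ℝ → Y → Y → ℝ := fun P R p x => if p ∈ P then max (R - dist x p) 0 else 0
  have bump_nonneg : ∀ P R p x, 0 ≤ bump P R p x := fun P R p x => by
    simp only [bump]; split_ifs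
    · exact le_max_right _ _
    · exact le_rfl
  have bump_lip : ∀ P R p x y, |bump P R p x - bump P R p y| ≤ dist x y := fun P R p x y => by
    simp only [bump]; split_ifs
    · refine (abs_max_sub_max_le_abs _ _ _).trans ?_
      rw [show R - dist x p - (R - dist y p) = dist y p - dist x p by ring, dist_comm x y]
      exact abs_dist_sub_le _ _ _
    · simp
  have bump_le : ∀ P R p x, 0 ≤ R → bump P R p x ≤ R := fun P R p x hR => by
    simp only [bump]; split_ifs
    · exact max_le (by linarith [dist_nonneg (x := x) (y := p)]) hR
    · exact hR
  have bump_ne : ∀ P R p x, bump P R p x ≠ 0 → p ∈ P ∧ dist x p < R := fun P R p x h => by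
    simp only [bump] at h
    split_ifs at h with hp
    · refine ⟨hp, ?_⟩
      by_contra! hR
      exact h (max_eq_right (by linarith))
    · exact absurd rfl h
  have bump_ge : ∀ P R p x, p ∈ P → R - dist x p ≤ bump P R p x := fun P R p x hp => by
    simp only [bump, if_pos hp]; exact le_max_left _ _
  -- Light bumps active at `x` have centres within `t` of one another, so one light centre bounds
  -- their number.
  have hmultL : ∀ x, ((AL.filter fun p => dist x p < t / 2).card : ℝ) ≤ m := fun x => by
    rcases (AL.filter fun p => dist x p < t / 2).eq_empty_or_nonempty with h | ⟨p, hp⟩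
    · rw [h]; simpa using hm.le
    · obtain ⟨hpL, hpx⟩ := Finset.mem_filter.1 hp
      refine le_trans ?_ (Finset.mem_filter.1 hpL).2.le
      refine Nat.cast_le.2 (Finset.card_le_card fun q hq => ?_)
      obtain ⟨hqL, hqx⟩ := Finset.mem_filter.1 hq
      refine Finset.mem_filter.2 ⟨(Finset.mem_filter.1 hqL).1, ?_⟩
      have := dist_triangle_left q p x
      linarith
  -- Each active heavy centre has at least `m` net points of its own, and all of them lie within `5
  -- t` of `x`, where there are at most `m ^ 2`.
  have hmultH : ∀ x, ((B.filter fun p => dist x p < 4 * t).card : ℝ) ≤ m := fun x => by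
    set B' := B.filter fun p => dist x p < 4 * t
    have h1 : ((B'.biUnion fun p => A.filter fun a => dist a p ≤ t).card : ℝ) ≤ m ^ 2 := by
      refine hpack x _ (fun a ha => ?_) fun a ha a' ha' => ?_
      · obtain ⟨p, hp, ha⟩ := Finset.mem_biUnion.1 ha
        have h1 := (Finset.mem_filter.1 ha).2
        have h2 := (Finset.mem_filter.1 hp).2
        have := dist_triangle_right a x p
        linarith
      · obtain ⟨p, hp, ha⟩ := Finset.mem_biUnion.1 ha
        obtain ⟨p', hp', ha'⟩ := Finset.mem_biUnion.1 ha'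
        exact hAsep a (Finset.mem_filter.1 ha).1 a' (Finset.mem_filter.1 ha').1
    rw [Finset.card_biUnion] at h1
    · have h2 : (B'.card : ℝ) * m ≤ m ^ 2 := by
        refine le_trans ?_ h1
        push_cast
        rw [← nsmul_eq_mul]
        exact Finset.card_nsmul_le_sum _ _ _ fun p hp =>
          (Finset.mem_filter.1 (hBH (Finset.mem_filter.1 hp).1)).2
      nlinarith
    · intro p hp q hq hpq
      refine Finset.disjoint_left.2 fun a ha ha' => ?_
      have h1 := (Finset.mem_filter.1 ha).2
      have h2 := (Finset.mem_filter.1 ha').2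
      have h3 := hBsep p (Finset.mem_filter.1 hp).1 q (Finset.mem_filter.1 hq).1 hpq
      have := dist_triangle_left p q a
      linarith
  refine ⟨Sum.elim (bump AL (t / 2)) (bump B (4 * t)), ?_, ?_, ?_, fun x => ?_, ?_, fun x => ?_⟩
  · rintro (p | p) x <;> exact bump_nonneg _ _ _ _
  · rintro (p | p) x y <;> exact bump_lip _ _ _ _ _
  · rintro (p | p) x
    · exact (bump_le _ _ _ _ (by positivity)).trans (by linarith)
    · exact bump_le _ _ _ _ (by positivity)
  · have h : {p | Sum.elim (bump AL (t / 2)) (bump B (4 * t)) p x ≠ 0} ⊆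
        (((AL.filter fun p => dist x p < t / 2).disjSum
          (B.filter fun p => dist x p < 4 * t) : Finset (Y ⊕ Y)) : Set (Y ⊕ Y)) := by
      rintro (p | p) hp
      · exact Finset.mem_coe.2 (Finset.inl_mem_disjSum.2 (Finset.mem_filter.2 (bump_ne _ _ _ _ hp)))
      · exact Finset.mem_coe.2 (Finset.inr_mem_disjSum.2 (Finset.mem_filter.2 (bump_ne _ _ _ _ hp)))
    have h2 := Set.ncard_le_ncard h (Finset.finite_toSet _)
    rw [Set.ncard_coe_finset, Finset.card_disjSum] at h2
    have h3 : ({p | Sum.elim (bump AL (t / 2)) (bump B (4 * t)) p x ≠ 0}.ncard : ℝ) ≤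
      ((AL.filter fun p => dist x p < t / 2).card : ℝ) +
        ((B.filter fun p => dist x p < 4 * t).card : ℝ) := by exact_mod_cast h2
    linarith [hmultL x, hmultH x]
  · have aux : ∀ P R p x y, R ≤ 4 * t → bump P R p x ≠ 0 → bump P R p y ≠ 0 →
        dist x y ≤ 8 * t := fun P R p x y hR hx hy => by
      have h1 := (bump_ne _ _ _ _ hx).2
      have h2 := (bump_ne _ _ _ _ hy).2
      have := dist_triangle_right x y p
      linarith
    rintro (p | p) x y hx hy
    · exact aux _ _ _ _ _ (by linarith) hx hy
    · exact aux _ _ _ _ _ le_rfl hx hy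
  · obtain ⟨p, hpA, hp⟩ := hAnet x (Finset.mem_univ _)
    by_cases hd : deg p < m
    · refine ⟨Sum.inl p, le_trans ?_ (bump_ge _ _ _ _ (Finset.mem_filter.2 ⟨hpA, hd⟩))⟩
      linarith
    · obtain ⟨p', hp'B, hp'⟩ := hBnet p (Finset.mem_filter.2 ⟨hpA, not_lt.1 hd⟩)
      refine ⟨Sum.inr p', le_trans ?_ (bump_ge _ _ _ _ hp'B)⟩
      have := dist_triangle x p p'
      linarith

/-! ### Digit coefficients chosen by the local lemma. -/

/-- A random combination of bumps separates the pairs of `T` at scale `t`, whatever the prior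
map `c` is. -/
theorem exists_separating_combination {Y ι : Type*} [MetricSpace Y] [Fintype Y] [Fintype ι]
    (b : ι → Y → ℝ) {t m : ℝ} (ht : 0 < t)
    (hb0 : ∀ p x, 0 ≤ b p x) (hblip : ∀ p x y, |b p x - b p y| ≤ dist x y)
    (hb4 : ∀ p x, b p x ≤ 4 * t) (hmult : ∀ x, ({p | b p x ≠ 0}.ncard : ℝ) ≤ 2 * m)
    (hdiam : ∀ p x y, b p x ≠ 0 → b p y ≠ 0 → dist x y ≤ 8 * t) (hbig : ∀ x, ∃ p, t / 4 ≤ b p x)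
    (T : Finset Y) (r : ℝ) (N q : ℕ) (hq : 0 < q) (Δ : ℕ)
    (hΔ : ∀ p, {e : Y × Y | e.1 ∈ T ∧ e.2 ∈ T ∧ dist e.1 e.2 ≤ r ∧
      (b p e.1 ≠ 0 ∨ b p e.2 ≠ 0)}.ncard ≤ Δ)
    (hΔq : 4 * Δ ≤ q ^ N) (c : Y → Fin N → ℝ) {ω : ℝ} (hω : 0 < ω) :
    ∃ ψ : Y → Fin N → ℝ, (∀ x y, ‖ψ x - ψ y‖ ≤ ω * (4 * m) * dist x y) ∧
      (∀ x, ‖ψ x‖ ≤ ω * (8 * m * t)) ∧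
      ∀ x ∈ T, ∀ y ∈ T, 8 * t < dist x y → dist x y ≤ r →
        ω * (t / 4) / (2 * q) ≤ ‖(c x + ψ x) - (c y + ψ y)‖ := by
  classical
  have hq' : (0 : ℝ) < q := Nat.cast_pos.2 hq
  have : Nonempty (Fin q) := ⟨⟨0, hq⟩⟩
  let act : Y → Finset ι := fun x => Finset.univ.filter fun p => b p x ≠ 0
  have hact : ∀ x, ((act x).card : ℝ) ≤ 2 * m := fun x => by
    have := hmult x
    rwa [Set.ncard_eq_toFinset_card', Set.toFinset_ofPred] at this
  let ψ : (ι → Fin N → Fin q) → Y → Fin N → ℝ := fun θ x i =>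
    ω * ∑ p, ((θ p i : ℕ) : ℝ) / q * b p x
  have hθ0 : ∀ (θ : ι → Fin N → Fin q) p i, (0 : ℝ) ≤ ((θ p i : ℕ) : ℝ) / q := fun θ p i => by
    positivity
  have hθ1 : ∀ (θ : ι → Fin N → Fin q) p i, ((θ p i : ℕ) : ℝ) / q ≤ 1 := fun θ p i => by
    rw [div_le_one hq']; exact_mod_cast (θ p i).2.le
  have hψsub : ∀ θ x y i, ψ θ x i - ψ θ y i =
      ω * ∑ p, ((θ p i : ℕ) : ℝ) / q * (b p x - b p y) := fun θ x y i => by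
    simp only [ψ, ← mul_sub, ← Finset.sum_sub_distrib]
  choose P hP using hbig
  let E := {e : Y × Y // e.1 ∈ T ∧ e.2 ∈ T ∧ 8 * t < dist e.1 e.2 ∧ dist e.1 e.2 ≤ r}
  have hmain : ∃ θ : ι → Fin N → Fin q, ∀ e : E, ¬ ‖(c e.1.1 + ψ θ e.1.1) -
      (c e.1.2 + ψ θ e.1.2)‖ < ω * (t / 4) / (2 * q) := by
    -- The pair `(x, y)` owns a bump that is large at `x`; it vanishes at `y`, since its support has
    -- diameter at most `8 t < dist x y`.
    refine exists_forall_not_bad (V := ι) (Q := Fin N → Fin q) (E := E)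
      (fun e => act e.1.1 ∪ act e.1.2) (fun e => P e.1.1)
      (fun e θ => ‖(c e.1.1 + ψ θ e.1.1) - (c e.1.2 + ψ θ e.1.2)‖ < ω * (t / 4) / (2 * q))
      (fun e => ?_) (fun e f f' hff hbad => ?_) (fun e f a a' ha ha' => ?_) Δ (fun p => ?_)
      (by simpa using hΔq)
    · refine Finset.mem_union_left _ (Finset.mem_filter.2 ⟨Finset.mem_univ _, ?_⟩)
      have := hP e.1.1
      intro h
      rw [h] at this
      linarith
    · have hz : ∀ x, act x ⊆ act e.1.1 ∪ act e.1.2 → ψ f x = ψ f' x := by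
        intro x hx
        ext i
        refine congrArg (ω * ·) (Finset.sum_congr rfl fun p _ => ?_)
        by_cases hp : p ∈ act x
        · rw [hff p (hx hp)]
        · simp only [act, Finset.mem_filter, Finset.mem_univ, true_and, not_not] at hp
          rw [hp]; simp
      rw [hz e.1.1 Finset.subset_union_left, hz e.1.2 Finset.subset_union_right] at hbad
      exact hbad
    · obtain ⟨⟨x, y⟩, hx, hy, h1, h2⟩ := e
      simp only at ha ha' h1
      have hbx : t / 4 ≤ b (P x) x := hP x
      have hby : b (P x) y = 0 := by
        by_contra hne
        have := hdiam (P x) x y (by intro h; rw [h] at hbx; linarith) hne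
        linarith
      have hval : ∀ (a : Fin N → Fin q) i, (c x + ψ (Function.update f (P x) a) x -
          (c y + ψ (Function.update f (P x) a) y)) i = (c x i - c y i) +
            ω * (((a i : ℕ) : ℝ) / q * b (P x) x + ∑ p ∈ Finset.univ.erase (P x),
              ((f p i : ℕ) : ℝ) / q * (b p x - b p y)) := by
        intro a i
        have : (c x + ψ (Function.update f (P x) a) x -
          (c y + ψ (Function.update f (P x) a) y)) i = (c x i - c y i) +
            (ψ (Function.update f (P x) a) x i - ψ (Function.update f (P x) a) y i) := by
          simp only [Pi.sub_apply, Pi.add_apply]; ring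
        rw [this, hψsub, ← Finset.add_sum_erase _ _ (Finset.mem_univ (P x))]
        simp only [Function.update_self, hby, sub_zero]
        congr 3
        refine Finset.sum_congr rfl fun p hp => ?_
        rw [Function.update_of_ne (Finset.ne_of_mem_erase hp)]
      ext i
      by_contra hne
      have hi := (norm_le_pi_norm _ i).trans_lt ha
      have hi' := (norm_le_pi_norm _ i).trans_lt ha'
      rw [hval, Real.norm_eq_abs] at hi hi'
      have hsub := (abs_sub _ _).trans_lt (add_lt_add hi hi')
      rw [show ∀ u v w z k : ℝ, u + ω * (v * k + w) - (u + ω * (z * k + w)) = ω * k * (v - z) from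
        fun u v w z k => by ring, ← sub_div, abs_mul, abs_div, abs_of_pos hq',
        abs_of_nonneg (mul_nonneg hω.le (hb0 _ _))] at hsub
      -- Changing one digit of the owned coefficient moves that coordinate of the difference by at
      -- least `ω (t / 4) / q`, the width of the bad window, so two different values cannot both be
      -- bad.
      have hone : (1 : ℝ) ≤ |((a i : ℕ) : ℝ) - ((a' i : ℕ) : ℝ)| := by
        have hz : ((a i : ℕ) : ℤ) - ((a' i : ℕ) : ℤ) ≠ 0 := by omega
        have := Int.one_le_abs hz
        exact_mod_cast this
      have : ω * (t / 4) * (1 / q) ≤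
          ω * b (P x) x * (|((a i : ℕ) : ℝ) - ((a' i : ℕ) : ℝ)| / q) := by
        have := hb0 (P x) x
        gcongr
      have h3 : ω * (t / 4) / (2 * q) + ω * (t / 4) / (2 * q) = ω * (t / 4) * (1 / q) := by
        field_simp; ring
      linarith
    · refine le_trans ?_ (hΔ p)
      rw [← Set.ncard_image_of_injective _ Subtype.val_injective]
      refine Set.ncard_le_ncard ?_ (Set.toFinite _)
      rintro _ ⟨⟨e, he1, he2, he3, he4⟩, he, rfl⟩
      refine ⟨he1, he2, he4, ?_⟩
      have he' : p ∈ act e.1 ∪ act e.2 := he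
      simpa [act] using he'
  obtain ⟨θ, hθ⟩ := hmain
  refine ⟨ψ θ, fun x y => ?_, fun x => ?_, fun x hx y hy h1 h2 => ?_⟩
  · have hm0 : 0 ≤ m := by
      have := hact x
      have h0 : (0 : ℝ) ≤ (act x).card := Nat.cast_nonneg _
      linarith
    refine (pi_norm_le_iff_of_nonneg (by positivity)).2 fun i => ?_
    rw [Pi.sub_apply, hψsub, Real.norm_eq_abs, abs_mul, abs_of_pos hω, mul_assoc]
    refine mul_le_mul_of_nonneg_left ?_ hω.le
    have hsum : ∑ p, ((θ p i : ℕ) : ℝ) / q * (b p x - b p y) =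
        ∑ p ∈ act x ∪ act y, ((θ p i : ℕ) : ℝ) / q * (b p x - b p y) := by
      refine (Finset.sum_subset (Finset.subset_univ _) fun p _ hp => ?_).symm
      simp only [act, Finset.mem_union, Finset.mem_filter, Finset.mem_univ, true_and, not_or,
        not_not] at hp
      rw [hp.1, hp.2]; simp
    rw [hsum]
    refine (Finset.abs_sum_le_sum_abs _ _).trans ?_
    refine (Finset.sum_le_card_nsmul _ _ (dist x y) fun p _ => ?_).trans ?_
    · rw [abs_mul, abs_of_nonneg (hθ0 θ p i)]
      calc _ ≤ 1 * dist x y := mul_le_mul (hθ1 θ p i) (hblip p x y) (abs_nonneg _) zero_le_one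
        _ = _ := one_mul _
    · rw [nsmul_eq_mul]
      refine mul_le_mul_of_nonneg_right ?_ dist_nonneg
      have : ((act x ∪ act y).card : ℝ) ≤ (act x).card + (act y).card := by
        exact_mod_cast Finset.card_union_le _ _
      linarith [hact x, hact y]
  · have hm0 : 0 ≤ m := by
      have := hact x
      have h0 : (0 : ℝ) ≤ (act x).card := Nat.cast_nonneg _
      linarith
    refine (pi_norm_le_iff_of_nonneg (by positivity)).2 fun i => ?_
    have h0 : 0 ≤ ∑ p, ((θ p i : ℕ) : ℝ) / q * b p x :=
      Finset.sum_nonneg fun p _ => mul_nonneg (hθ0 θ p i) (hb0 p x)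
    rw [Real.norm_eq_abs, abs_of_nonneg (mul_nonneg hω.le h0)]
    refine mul_le_mul_of_nonneg_left ?_ hω.le
    have hsum : ∑ p, ((θ p i : ℕ) : ℝ) / q * b p x =
        ∑ p ∈ act x, ((θ p i : ℕ) : ℝ) / q * b p x := by
      refine (Finset.sum_subset (Finset.subset_univ _) fun p _ hp => ?_).symm
      simp only [act, Finset.mem_filter, Finset.mem_univ, true_and, not_not] at hp
      rw [hp]; simp
    rw [hsum]
    refine (Finset.sum_le_card_nsmul _ _ (4 * t) fun p _ => ?_).trans ?_
    · calc _ ≤ 1 * (4 * t) := mul_le_mul (hθ1 θ p i) (hb4 p x) (hb0 p x) zero_le_one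
        _ = _ := one_mul _
    · rw [nsmul_eq_mul]
      nlinarith [hact x]
  · exact not_lt.1 (hθ ⟨(x, y), hx, hy, h1, h2⟩)

/-! ### Packing bounds and estimates for `slog`. -/

/-- The packing form of almost homogeneity of a metric space. -/
def PackingBound (Y : Type*) [MetricSpace Y] (α β M s : ℝ) : Prop :=
  ∀ (x : Y) (R ρ : ℝ), 0 < ρ → ρ < R → ∀ S : Finset Y, (∀ p ∈ S, dist p x ≤ R) →
    (∀ p ∈ S, ∀ q ∈ S, p ≠ q → 2 * ρ < dist p q) →
      (S.card : ℝ) ≤ M * (R / ρ) ^ s * slog R ^ α * slog ρ ^ β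

theorem log_two_le_slog {x : ℝ} (hx : 0 < x) : Real.log 2 ≤ slog x := by
  refine Real.log_le_log two_pos ?_
  have h : x + 1 / x - 2 = (x - 1) ^ 2 / x := by field_simp; ring
  have : 0 ≤ (x - 1) ^ 2 / x := by positivity
  linarith

theorem slog_pos {x : ℝ} (hx : 0 < x) : 0 < slog x :=
  (Real.log_pos one_lt_two).trans_le (log_two_le_slog hx)

theorem abs_log_le_slog {x : ℝ} (hx : 0 < x) : |Real.log x| ≤ slog x := by
  have h1 : 0 < 1 / x := by positivity
  refine abs_le'.2 ⟨Real.log_le_log hx (by linarith), ?_⟩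
  rw [← Real.log_inv, ← one_div]
  exact Real.log_le_log h1 (by linarith)

theorem slog_le {x : ℝ} (hx : 0 < x) : slog x ≤ Real.log 2 + |Real.log x| := by
  have h2 : slog x ≤ Real.log (2 * Real.exp |Real.log x|) := by
    refine Real.log_le_log (by positivity) ?_
    have h3 : x ≤ Real.exp |Real.log x| := by
      conv_lhs => rw [← Real.exp_log hx]
      exact Real.exp_le_exp.2 (le_abs_self _)
    have h4 : 1 / x ≤ Real.exp |Real.log x| := by
      rw [one_div, ← Real.exp_log (inv_pos.2 hx), Real.log_inv]
      exact Real.exp_le_exp.2 (neg_le_abs _)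
    linarith
  rwa [Real.log_mul two_ne_zero (Real.exp_ne_zero _), Real.log_exp] at h2

/-- The scales satisfy `|log r| ≲ g log g`, and the logarithm is absorbed by `g ^ (2 η)`. The factor
`u` covers all the radii `r * u` at which packing is later applied. -/
theorem eventually_slog_le {η D : ℝ} (hη : 0 < η) (hD : 0 ≤ D) :
    ∀ᶠ g : ℝ in Filter.atTop, ∀ r u : ℝ, 0 < r → |Real.log r| ≤ η * g * Real.log g →
      g ^ (-D) / 200 ≤ u → u ≤ 200 → slog (r * u) ≤ g ^ (1 + 2 * η) := by
  have hlog := (isLittleO_log_rpow_atTop (show 0 < 2 * η by positivity)).def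
    (show 0 < 1 / (2 * (η + D + 1)) by positivity)
  filter_upwards [hlog, Filter.eventually_ge_atTop 1,
    Filter.eventually_ge_atTop (2 * (Real.log 2 + Real.log 200))] with g h1 h2 h3 r u hr hr' hu hu'
  have hg : 0 < g := by linarith
  have hlg : 0 ≤ Real.log g := Real.log_nonneg h2
  have hgD : 0 < g ^ (-D) := Real.rpow_pos_of_pos hg _
  have hu0 : 0 < u := lt_of_lt_of_le (by positivity) hu
  rw [Real.norm_of_nonneg hlg, Real.norm_of_nonneg (by positivity)] at h1
  have hlu : |Real.log u| ≤ D * Real.log g + Real.log 200 := by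
    refine abs_le.2 ⟨?_, ?_⟩
    · have := Real.log_le_log (by positivity) hu
      rw [Real.log_div hgD.ne' (by norm_num), Real.log_rpow hg] at this
      linarith
    · have := Real.log_le_log hu0 hu'
      have : 0 ≤ D * Real.log g := by positivity
      linarith
  have hab : |Real.log (r * u)| ≤ |Real.log r| + |Real.log u| := by
    rw [Real.log_mul hr.ne' hu0.ne']; exact abs_add_le _ _
  have h4 := slog_le (mul_pos hr hu0)
  have hpow : g ^ (1 + 2 * η) = g * g ^ (2 * η) := by rw [Real.rpow_add hg, Real.rpow_one]
  have hone : 1 ≤ g ^ (2 * η) := Real.one_le_rpow h2 (by positivity)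
  have h5 : (η * g + D) * Real.log g ≤ g * g ^ (2 * η) / 2 := by
    calc (η * g + D) * Real.log g ≤ ((η + D + 1) * g) * (1 / (2 * (η + D + 1)) * g ^ (2 * η)) := by
          refine mul_le_mul ?_ h1 hlg (by positivity)
          nlinarith
      _ = _ := by field_simp
  have h6 : g ≤ g * g ^ (2 * η) := le_mul_of_one_le_right hg.le hone
  rw [hpow]
  linarith

theorem eventually_const_le_rpow (c : ℝ) {e : ℝ} (he : 0 < e) :
    ∀ᶠ g : ℝ in Filter.atTop, c ≤ g ^ e :=
  (tendsto_rpow_atTop he).eventually_ge_atTop c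

theorem PackingBound.card_le {Y : Type*} [MetricSpace Y] {α β M s : ℝ} (h : PackingBound Y α β M s)
    (hα : 0 ≤ α) (hβ : 0 ≤ β) (hM : 0 ≤ M) {R ρ B : ℝ} (hρ : 0 < ρ) (hR : ρ < R)
    (hRB : slog R ≤ B) (hρB : slog ρ ≤ B) (x : Y) (S : Finset Y)
    (hS : ∀ p ∈ S, dist p x ≤ R) (hsep : ∀ p ∈ S, ∀ q ∈ S, p ≠ q → 2 * ρ < dist p q) :
    (S.card : ℝ) ≤ M * (R / ρ) ^ s * B ^ (α + β) := by
  have hR0 : 0 < R := hρ.trans hR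
  have hB : 0 < B := (slog_pos hρ).trans_le hρB
  refine (h x R ρ hρ hR S hS hsep).trans ?_
  rw [Real.rpow_add hB, ← mul_assoc]
  have := slog_pos hρ
  have := slog_pos hR0
  gcongr

/-- Exponent count: Lipschitz weight `1 + η`, multiplicity `k`, bump size `η`, digit spacing `η`;
one more `η` absorbs the constants. The factor `2 Λ + 4` leaves `2` after `2 (Λ + 1)` is lost in
passing to a net. -/
theorem perturbation_size_ge {g k δ η Λ r q : ℝ} (hg1 : 1 ≤ g)
    (hδ : (1 + η) + k + 3 * η ≤ δ) (hgΛ : 1024 * (2 * Λ + 4) ≤ g ^ η) (hr : 0 < r) (hq0 : 0 < q)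
    (hq2 : q ≤ 2 * g ^ η) :
    (2 * Λ + 4) * (r * g ^ (-δ)) ≤
      g ^ (-(1 + η)) / (4 * g ^ k) * (r * g ^ (-η) / 16 / 4) / (2 * q) := by
  have hg : 0 < g := by linarith
  have hpos : ∀ e : ℝ, 0 < g ^ e := fun e => Real.rpow_pos_of_pos hg e
  have h1 := hpos k
  have h2 := hpos (-η)
  have h3 := hpos (-(1 + η))
  have hgδ := hpos (-δ)
  have e1 : g ^ (-(1 + η)) / (4 * g ^ k) * (r * g ^ (-η) / 16 / 4) / (2 * q) =
      r * (g ^ (-(1 + η)) * g ^ (-k) * g ^ (-η)) / (512 * q) := by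
    rw [Real.rpow_neg hg.le k]; field_simp; norm_num
  have e2 : r * (g ^ (-(1 + η)) * g ^ (-k) * g ^ (-η)) / (512 * (2 * g ^ η)) ≤
      r * (g ^ (-(1 + η)) * g ^ (-k) * g ^ (-η)) / (512 * q) := by
    have := hpos (-k)
    gcongr
  have e3 : r * (g ^ (-(1 + η)) * g ^ (-k) * g ^ (-η)) / (512 * (2 * g ^ η)) =
      r * (g ^ (-(1 + η) + -k + -η + -η)) / 1024 := by
    rw [Real.rpow_add hg, Real.rpow_add hg, Real.rpow_add hg, Real.rpow_neg hg.le η]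
    field_simp; norm_num
  have e4 : g ^ (-δ) * g ^ η ≤ g ^ (-(1 + η) + -k + -η + -η) := by
    rw [← Real.rpow_add hg]
    exact Real.rpow_le_rpow_of_exponent_le hg1 (by linarith)
  rw [e1]
  refine le_trans ?_ (e3 ▸ e2)
  have e5 : g ^ (-δ) * (1024 * (2 * Λ + 4)) ≤ g ^ (-(1 + η) + -k + -η + -η) :=
    (mul_le_mul_of_nonneg_left hgΛ hgδ.le).trans e4
  have e6 := mul_le_mul_of_nonneg_left e5 hr.le
  linarith

/-! ### The perturbation at a single scale. -/

/-- One scale of the construction: for large `g`, any Lipschitz map can be perturbed at scale `r` so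
that the pairs at distance between `r * g ^ (-η)` and `r` become separated. -/
theorem exists_separating_perturbation {α β M s δ η Λ : ℝ} (hα : 0 ≤ α) (hβ : 0 ≤ β) (hM : 0 < M)
    (hη : 0 < η) (hΛ : 0 ≤ Λ)
    (hδ : (1 + η) + ((1 + 2 * η) * (α + β) + η) / 2 + 3 * η ≤ δ) :
    ∃ N : ℕ, ∀ᶠ g : ℝ in Filter.atTop, ∀ r : ℝ, 0 < r → |Real.log r| ≤ η * g * Real.log g →
      ∀ (Y : Type u) [MetricSpace Y] [Fintype Y], PackingBound Y α β M s →
      ∀ c : Y → Fin N → ℝ, (∀ x y, ‖c x - c y‖ ≤ Λ * dist x y) →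
      ∃ ψ : Y → Fin N → ℝ, (∀ x y, ‖ψ x - ψ y‖ ≤ g ^ (-(1 + η)) * dist x y) ∧
        (∀ x, ‖ψ x‖ ≤ g ^ (-(1 + η)) * r / 2) ∧
        ∀ x y, r * g ^ (-η) < dist x y → dist x y ≤ r →
          2 * (r * g ^ (-δ)) ≤ ‖(c x + ψ x) - (c y + ψ y)‖ := by
  -- `g ^ k` is the bump multiplicity, and `g ^ (2 k)` bounds the packing number; `g ^ E` will bound
  -- the number of net points near one bump.
  set k := ((1 + 2 * η) * (α + β) + η) / 2 with hk
  have hk0 : 0 ≤ k := by positivity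
  set E := δ * s + (1 + 2 * η) * (α + β) + 1 with hE
  have hδ0 : 0 ≤ δ := by linarith
  refine ⟨⌈(2 * E + 1) / η⌉₊, ?_⟩
  filter_upwards [eventually_slog_le hη hδ0, Filter.eventually_ge_atTop 4,
    eventually_const_le_rpow (M * 45 ^ s) hη, eventually_const_le_rpow (M * 12 ^ s) one_pos,
    eventually_const_le_rpow (1024 * (2 * Λ + 4)) hη] with g hslog hg4 hgM hgM' hgΛ
  intro r hr hlogr Y _ _ hY c hc
  have hg : 0 < g := by linarith
  have hg1 : 1 ≤ g := by linarith
  have hneg : ∀ e : ℝ, 0 ≤ e → g ^ (-e) ≤ 1 := fun e he =>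
    Real.rpow_le_one_of_one_le_of_nonpos hg1 (by linarith)
  have hpos : ∀ e : ℝ, 0 < g ^ e := fun e => Real.rpow_pos_of_pos hg e
  have hδη : g ^ (-δ) ≤ g ^ (-η) / 4 := by
    have h1 : g ^ (-δ) ≤ g ^ (-η - 1) := Real.rpow_le_rpow_of_exponent_le hg1 (by linarith)
    rw [Real.rpow_sub_one hg.ne'] at h1
    refine h1.trans ?_
    have := hpos (-η)
    gcongr
  set B := g ^ (1 + 2 * η) with hB
  have hBab : B ^ (α + β) = g ^ ((1 + 2 * η) * (α + β)) := by rw [hB, ← Real.rpow_mul hg.le]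
  have hgδ := hpos (-δ)
  have hgη := hpos (-η)
  have hη1 := hneg η hη.le
  set t := r * g ^ (-η) / 16 with ht_def
  have ht : 0 < t := by positivity
  have htr : 16 * t ≤ r := by rw [ht_def]; nlinarith
  obtain ⟨b, hb0, hblip, hb4, hmult, hdiam, hbig⟩ := exists_bumps (Y := Y) ht (hpos k)
    (fun x S hS hsep => by
      have := hY.card_le hα hβ hM.le (R := 5 * t) (ρ := t / 9) (B := B) (by positivity)
        (by linarith) (by
          rw [show 5 * t = r * (5 * g ^ (-η) / 16) by rw [ht_def]; ring]
          exact hslog r _ hr hlogr (by linarith) (by linarith)) (by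
          rw [show t / 9 = r * (g ^ (-η) / 144) by rw [ht_def]; ring]
          exact hslog r _ hr hlogr (by linarith) (by linarith)) x S hS
        (fun p hp q hq hpq => by have := hsep p hp q hq hpq; linarith)
      refine this.trans ?_
      rw [show 5 * t / (t / 9) = 45 by field_simp; norm_num, hBab, ← Real.rpow_natCast,
        ← Real.rpow_mul hg.le, show k * ((2 : ℕ) : ℝ) = η + (1 + 2 * η) * (α + β) by
          rw [hk]; push_cast; ring, Real.rpow_add hg]
      exact mul_le_mul_of_nonneg_right hgM (hpos _).le)
  set ρ := r * g ^ (-δ) with hρ_def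
  have hρ : 0 < ρ := by positivity
  have hρt : ρ ≤ 4 * t := by rw [hρ_def, ht_def]; nlinarith
  -- Only pairs in this net are constrained, which keeps the dependency degree below a power of `g`.
  -- The mesh `ρ` is as small as the separation sought.
  obtain ⟨T, -, hTsep, hTnet⟩ := exists_maximal_separated (Finset.univ : Finset Y) hρ
  set q := ⌈g ^ η⌉₊ with hq_def
  have hgη1 : 1 ≤ g ^ η := Real.one_le_rpow hg1 hη.le
  have hqg : g ^ η ≤ q := Nat.le_ceil _
  have hq2 : (q : ℝ) ≤ 2 * g ^ η := by
    have := Nat.ceil_lt_add_one (hpos η).le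
    linarith
  have hq : 0 < q := Nat.ceil_pos.2 (hpos η)
  -- With multiplicity `g ^ k`, this amplitude makes the Lipschitz constant `ω * (4 * g ^ k)`
  -- exactly `g ^ (-(1 + η))`.
  have hω : 0 < g ^ (-(1 + η)) / (4 * g ^ k) := div_pos (hpos _) (by have := hpos k; positivity)
  obtain ⟨ψ, hψ1, hψ2, hψ3⟩ := exists_separating_combination b ht hb0 hblip hb4 hmult hdiam hbig
    T (2 * r) ⌈(2 * E + 1) / η⌉₊ q hq ⌊g ^ (2 * E)⌋₊ (fun p => by
      refine Nat.le_floor ?_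
      by_cases hx0 : ∃ x0, b p x0 ≠ 0
      · obtain ⟨x0, hx0⟩ := hx0
        classical
        set W := T.filter fun x => dist x x0 ≤ 4 * r with hW
        have hWc : (W.card : ℝ) ≤ g ^ E := by
          have := hY.card_le hα hβ hM.le (R := 4 * r) (ρ := ρ / 3) (B := B) (by positivity)
            (by linarith) (by
              rw [show 4 * r = r * 4 by ring]
              exact hslog r _ hr hlogr (by linarith) (by norm_num)) (by
              rw [show ρ / 3 = r * (g ^ (-δ) / 3) by rw [hρ_def]; ring]
              exact hslog r _ hr hlogr (by linarith) (by linarith)) x0 W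
            (fun p hp => (Finset.mem_filter.1 hp).2)
            (fun p hp q hq hpq => by
              have := hTsep p (Finset.mem_filter.1 hp).1 q (Finset.mem_filter.1 hq).1 hpq
              linarith)
          refine this.trans ?_
          have h12 : 4 * r / (ρ / 3) = 12 * g ^ δ := by
            rw [hρ_def, Real.rpow_neg hg.le]; field_simp; norm_num
          rw [h12, Real.mul_rpow (by norm_num) (hpos δ).le, ← Real.rpow_mul hg.le, hBab, hE,
            Real.rpow_add hg, Real.rpow_add hg]
          have h1 := hpos (δ * s)
          have h2 := hpos ((1 + 2 * η) * (α + β))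
          calc _ = (M * 12 ^ s) * (g ^ (δ * s) * g ^ ((1 + 2 * η) * (α + β))) := by ring
            _ ≤ g ^ (1 : ℝ) * (g ^ (δ * s) * g ^ ((1 + 2 * η) * (α + β))) := by gcongr
            _ = _ := by ring
        have hsub : {e : Y × Y | e.1 ∈ T ∧ e.2 ∈ T ∧ dist e.1 e.2 ≤ 2 * r ∧
            (b p e.1 ≠ 0 ∨ b p e.2 ≠ 0)} ⊆ ((W ×ˢ W : Finset (Y × Y)) : Set (Y × Y)) := by
          rintro ⟨x, y⟩ ⟨hx, hy, hd, hxy⟩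
          simp only at hx hy hd hxy
          have hboth : dist x x0 ≤ 4 * r ∧ dist y x0 ≤ 4 * r := by
            rcases hxy with h | h
            · have h1 := hdiam p _ _ h hx0
              have h2 := dist_triangle_left y x0 x
              constructor <;> linarith
            · have h1 := hdiam p _ _ h hx0
              have h2 := dist_triangle x y x0
              constructor <;> linarith
          exact Finset.mem_coe.2 (Finset.mem_product.2
            ⟨Finset.mem_filter.2 ⟨hx, hboth.1⟩, Finset.mem_filter.2 ⟨hy, hboth.2⟩⟩)
        have h1 := Set.ncard_le_ncard hsub (Finset.finite_toSet _)
        rw [Set.ncard_coe_finset, Finset.card_product] at h1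
        have h2 : ((W.card * W.card : ℕ) : ℝ) ≤ g ^ (2 * E) := by
          rw [two_mul, Real.rpow_add hg]
          push_cast
          gcongr
        exact le_trans (by exact_mod_cast h1) h2
      · push Not at hx0
        have : {e : Y × Y | e.1 ∈ T ∧ e.2 ∈ T ∧ dist e.1 e.2 ≤ 2 * r ∧
            (b p e.1 ≠ 0 ∨ b p e.2 ≠ 0)} = ∅ := by
          ext e; simp [hx0]
        rw [this]
        simpa using (hpos _).le) (by
      have h1 : (⌊g ^ (2 * E)⌋₊ : ℝ) ≤ g ^ (2 * E) := Nat.floor_le (hpos _).le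
      -- The number of digits is about `g ^ η`, so a fixed number of coordinates beats any fixed
      -- power of `g`.
      have h2 : g ^ (2 * E + 1) ≤ (g ^ η) ^ ⌈(2 * E + 1) / η⌉₊ := by
        rw [← Real.rpow_natCast, ← Real.rpow_mul hg.le]
        refine Real.rpow_le_rpow_of_exponent_le hg1 ?_
        have := Nat.le_ceil ((2 * E + 1) / η)
        rw [div_le_iff₀ hη] at this
        linarith
      have h3 : (g ^ η) ^ ⌈(2 * E + 1) / η⌉₊ ≤ (q : ℝ) ^ ⌈(2 * E + 1) / η⌉₊ := by
        gcongr
      have h4 : (4 * ⌊g ^ (2 * E)⌋₊ : ℝ) ≤ (q : ℝ) ^ ⌈(2 * E + 1) / η⌉₊ := by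
        refine le_trans ?_ (h2.trans h3)
        rw [Real.rpow_add hg, Real.rpow_one]
        have := hpos (2 * E)
        nlinarith
      exact_mod_cast h4) c hω
  have hgk := hpos k
  have hga := hpos (-(1 + η))
  have hga1 := hneg (1 + η) (by linarith)
  have hψ1' : ∀ x y, ‖ψ x - ψ y‖ ≤ g ^ (-(1 + η)) * dist x y := fun x y => by
    have := hψ1 x y
    rwa [div_mul_cancel₀ _ (by positivity)] at this
  refine ⟨ψ, hψ1', fun x => (hψ2 x).trans ?_, fun x y hxy hxyr => ?_⟩
  · rw [show g ^ (-(1 + η)) / (4 * g ^ k) * (8 * g ^ k * t) = g ^ (-(1 + η)) * (2 * t) by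
      field_simp; norm_num, mul_div_assoc]
    exact mul_le_mul_of_nonneg_left (by linarith) hga.le
  · obtain ⟨x', hx'T, hx'⟩ := hTnet x (Finset.mem_univ _)
    obtain ⟨y', hy'T, hy'⟩ := hTnet y (Finset.mem_univ _)
    have hxy16 : 16 * t < dist x y := by rw [ht_def]; linarith
    have hd1 : dist x y ≤ dist x x' + dist x' y' + dist y y' := by
      have := dist_triangle4 x x' y' y
      rwa [dist_comm y' y] at this
    have hd2 : dist x' y' ≤ dist x x' + dist x y + dist y y' := by
      have := dist_triangle4 x' x y y'
      rwa [dist_comm x' x] at this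
    have hsep := hψ3 x' hx'T y' hy'T (by
      have : ρ ≤ 4 * t := hρt
      nlinarith) (by linarith)
    have hlip : ∀ u v, ‖(c u + ψ u) - (c v + ψ v)‖ ≤ (Λ + 1) * dist u v := fun u v => by
      rw [add_sub_add_comm]
      refine (norm_add_le _ _).trans ?_
      have h1 := hc u v
      have h2 := hψ1' u v
      have h3 : g ^ (-(1 + η)) * dist u v ≤ 1 * dist u v :=
        mul_le_mul_of_nonneg_right hga1 dist_nonneg
      linarith
    have htri : ‖(c x' + ψ x') - (c y' + ψ y')‖ ≤ ‖(c x + ψ x) - (c y + ψ y)‖ +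
        2 * (Λ + 1) * ρ := by
      have h1 := hlip x' x
      have h2 := hlip y y'
      rw [dist_comm] at h1
      have h3 : ‖(c x' + ψ x') - (c y' + ψ y')‖ ≤ ‖(c x' + ψ x') - (c x + ψ x)‖ +
          ‖(c x + ψ x) - (c y + ψ y)‖ + ‖(c y + ψ y) - (c y' + ψ y')‖ := by
        simp only [← dist_eq_norm]
        exact dist_triangle4 _ _ _ _
      linarith [mul_le_mul_of_nonneg_left hx'.le (show 0 ≤ Λ + 1 by linarith),
        mul_le_mul_of_nonneg_left hy'.le (show 0 ≤ Λ + 1 by linarith)]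
    have hlow := perturbation_size_ge hg1 hδ hgΛ hr (Nat.cast_pos.2 hq) hq2
    rw [← hρ_def, ← ht_def] at hlow
    linarith

/-! ### Summation over scales, and the choice of scales. -/

/-- Perturbations at rapidly decreasing scales add up to one map that separates at every scale. -/
theorem exists_sum_perturbations {Y F : Type*} [MetricSpace Y] [NormedAddCommGroup F]
    {Λ : ℝ} (w R lo σ : ℕ → ℝ) (hw : ∀ j, 0 ≤ w j) (hR : ∀ j, 0 ≤ R j)
    (hRanti : Antitone R) (hΛ : ∀ J, ∑ j ∈ Finset.range J, w j ≤ Λ)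
    (hstage : ∀ j, ∀ c : Y → F, (∀ x y, ‖c x - c y‖ ≤ Λ * dist x y) →
      ∃ ψ : Y → F, (∀ x y, ‖ψ x - ψ y‖ ≤ w j * dist x y) ∧ (∀ x, ‖ψ x‖ ≤ w j * R j / 2) ∧
        ∀ x y, lo j < dist x y → dist x y ≤ R j → 2 * σ j ≤ ‖(c x + ψ x) - (c y + ψ y)‖)
    (htail : ∀ j, Λ * R (j + 1) ≤ σ j) (J : ℕ) :
    ∃ L : Y → F, (∀ x y, ‖L x - L y‖ ≤ Λ * dist x y) ∧
      ∀ j < J, ∀ x y, lo j < dist x y → dist x y ≤ R j → σ j ≤ ‖L x - L y‖ := by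
  have key : ∀ J, ∃ L : Y → F,
      (∀ x y, ‖L x - L y‖ ≤ (∑ j ∈ Finset.range J, w j) * dist x y) ∧
      ∀ j < J, ∀ x y, lo j < dist x y → dist x y ≤ R j →
        -- Stage `l` changes a difference by at most `w l * R l`; the total of all later changes is
        -- finally absorbed by one of the two `σ j`.
        2 * σ j - ∑ l ∈ Finset.Ico (j + 1) J, w l * R l ≤ ‖L x - L y‖ := by
    intro J
    induction J with
    | zero => exact ⟨0, by simp, by simp⟩
    | succ J ih =>
      obtain ⟨L, hL1, hL2⟩ := ih
      obtain ⟨ψ, h1, h2, h3⟩ := hstage J L fun x y =>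
        (hL1 x y).trans (mul_le_mul_of_nonneg_right (hΛ J) dist_nonneg)
      refine ⟨fun x => L x + ψ x, fun x y => ?_, fun j hj x y hlo hhi => ?_⟩
      · rw [add_sub_add_comm, Finset.sum_range_succ, add_mul]
        exact (norm_add_le _ _).trans (add_le_add (hL1 x y) (h1 x y))
      · rcases Nat.lt_succ_iff_lt_or_eq.1 hj with hj | rfl
        · rw [Finset.sum_Ico_succ_top hj]
          have h4 := hL2 j hj x y hlo hhi
          have h5 : ‖L x - L y‖ ≤ ‖(L x + ψ x) - (L y + ψ y)‖ + ‖ψ x - ψ y‖ := by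
            have := norm_sub_le ((L x + ψ x) - (L y + ψ y)) (ψ x - ψ y)
            rwa [add_sub_add_comm, add_sub_cancel_right, ← add_sub_add_comm] at this
          have h6 := norm_sub_le (ψ x) (ψ y)
          have h7 := h2 x
          have h8 := h2 y
          linarith
        · simpa using h3 x y hlo hhi
  obtain ⟨L, hL1, hL2⟩ := key J
  refine ⟨L, fun x y => (hL1 x y).trans (mul_le_mul_of_nonneg_right (hΛ J) dist_nonneg),
    fun j hj x y hlo hhi => ?_⟩
  have h1 := hL2 j hj x y hlo hhi
  have h2 : ∑ l ∈ Finset.Ico (j + 1) J, w l * R l ≤ Λ * R (j + 1) := by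
    calc _ ≤ ∑ l ∈ Finset.Ico (j + 1) J, w l * R (j + 1) :=
          Finset.sum_le_sum fun l hl => mul_le_mul_of_nonneg_left
            (hRanti (Finset.mem_Ico.1 hl).1) (hw l)
      _ = (∑ l ∈ Finset.Ico (j + 1) J, w l) * R (j + 1) := (Finset.sum_mul _ _ _).symm
      _ ≤ _ := by
        refine mul_le_mul_of_nonneg_right (le_trans ?_ (hΛ J)) (hR _)
        refine Finset.sum_le_sum_of_subset_of_nonneg (fun l hl => ?_) fun l _ _ => hw l
        exact Finset.mem_range.2 (Finset.mem_Ico.1 hl).2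
  linarith [htail j]

theorem summable_one_add_abs_int_rpow {b : ℝ} (hb : 1 < b) :
    Summable fun i : ℤ => (1 + |(i : ℝ)|) ^ (-b) := by
  have h : Summable fun n : ℕ => (1 + (n : ℝ)) ^ (-b) := by
    have := (summable_nat_add_iff 1).2 (Real.summable_nat_rpow.2 (show -b < -1 by linarith))
    refine this.congr fun n => ?_
    push_cast
    rw [add_comm]
  refine Summable.of_nat_of_neg (h.congr fun n => ?_) (h.congr fun n => ?_) <;> simp

/-- A sequence of scales with consecutive ratios `(A + |i|) ^ (-η)`. -/
theorem exists_scales {A η : ℝ} (hη : 0 < η) (hA1 : 1 ≤ A) (hA : 1 ≤ η * Real.log A) :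
    ∃ r : ℤ → ℝ, (∀ i, 0 < r i) ∧ (∀ i, r (i + 1) = r i * (A + |(i : ℝ)|) ^ (-η)) ∧
      (∀ i, |Real.log (r i)| ≤ η * (A + |(i : ℝ)|) * Real.log (A + |(i : ℝ)|)) ∧
      (∀ i, 0 ≤ i → Real.log (r i) ≤ -i) ∧ ∀ i : ℤ, i ≤ 0 → -(i : ℝ) ≤ Real.log (r i) := by
  have hg : ∀ x : ℝ, 0 < A + |x| := fun x => by positivity
  have hlogA : ∀ x : ℝ, Real.log A ≤ Real.log (A + |x|) := fun x =>
    Real.log_le_log (by linarith) (by linarith [abs_nonneg x])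
  have hlog0 : ∀ x : ℝ, 0 ≤ Real.log (A + |x|) := fun x =>
    (Real.log_nonneg hA1).trans (hlogA x)
  let S : ℤ → ℝ := fun i => ∑ j ∈ Finset.range i.toNat, Real.log (A + |(j : ℝ)|) -
    ∑ j ∈ Finset.range (-i).toNat, Real.log (A + |(j : ℝ) + 1|)
  have hSnat : ∀ n : ℕ, S n = ∑ j ∈ Finset.range n, Real.log (A + |(j : ℝ)|) := fun n => by
    simp [S]
  have hSneg : ∀ n : ℕ, S (-n) = -∑ j ∈ Finset.range n, Real.log (A + |(j : ℝ) + 1|) :=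
    fun n => by simp [S]
  have hSsucc : ∀ i, S (i + 1) = S i + Real.log (A + |(i : ℝ)|) := by
    intro i
    obtain ⟨n, rfl | rfl⟩ := i.eq_nat_or_neg
    · have := hSnat (n + 1)
      rw [Finset.sum_range_succ, ← hSnat] at this
      exact_mod_cast this
    · cases n with
      | zero => simp [S]
      | succ n =>
        rw [show (-((n + 1 : ℕ) : ℤ) + 1) = -(n : ℤ) by push_cast; ring, hSneg, hSneg,
          Finset.sum_range_succ]
        push_cast
        rw [abs_neg]
        ring
  have hup : ∀ i, 0 ≤ i → Real.log (Real.exp (-(η * S i))) ≤ -i := by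
    intro i hi
    lift i to ℕ using hi
    rw [Real.log_exp, hSnat]
    have : (n : ℕ) → n • Real.log A ≤ ∑ j ∈ Finset.range n, Real.log (A + |(j : ℝ)|) := fun n => by
      have := Finset.card_nsmul_le_sum (Finset.range n) (fun j : ℕ => Real.log (A + |(j : ℝ)|)) _
        fun j _ => hlogA j
      rwa [Finset.card_range] at this
    have h := mul_le_mul_of_nonneg_left (this i) hη.le
    rw [nsmul_eq_mul] at h
    have h0 : (0 : ℝ) ≤ i := Nat.cast_nonneg i
    push_cast
    nlinarith
  have hdown : ∀ i : ℤ, i ≤ 0 → -(i : ℝ) ≤ Real.log (Real.exp (-(η * S i))) := by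
    intro i hi
    obtain ⟨n, rfl⟩ := Int.exists_eq_neg_ofNat hi
    rw [Real.log_exp, hSneg]
    have := Finset.card_nsmul_le_sum (Finset.range n)
      (fun j : ℕ => Real.log (A + |(j : ℝ) + 1|)) _ fun j _ => hlogA _
    rw [Finset.card_range, nsmul_eq_mul] at this
    have h := mul_le_mul_of_nonneg_left this hη.le
    have h0 : (0 : ℝ) ≤ n := Nat.cast_nonneg n
    push_cast
    nlinarith
  refine ⟨fun i => Real.exp (-(η * S i)), fun i => Real.exp_pos _, fun i => ?_, fun i => ?_,
    hup, hdown⟩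
  · simp only [hSsucc]
    rw [Real.rpow_def_of_pos (hg _), ← Real.exp_add]
    congr 1
    ring
  · rw [Real.log_exp, abs_neg, abs_mul, abs_of_pos hη, mul_assoc]
    refine mul_le_mul_of_nonneg_left ?_ hη.le
    have haux : |S i| ≤ |(i : ℝ)| * Real.log (A + |(i : ℝ)|) := by
      obtain ⟨n, rfl | rfl⟩ := i.eq_nat_or_neg
      · rw [hSnat, abs_of_nonneg (Finset.sum_nonneg fun j _ => hlog0 _)]
        have := Finset.sum_le_card_nsmul (Finset.range n)
          (fun j : ℕ => Real.log (A + |(j : ℝ)|)) (Real.log (A + n)) fun j hj => by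
            have : (j : ℝ) ≤ n := by exact_mod_cast (Finset.mem_range.1 hj).le
            refine Real.log_le_log (hg _) ?_
            rw [abs_of_nonneg (Nat.cast_nonneg j)]
            linarith
        simpa using this
      · rw [hSneg, abs_neg, abs_of_nonneg (Finset.sum_nonneg fun j _ => hlog0 _)]
        have := Finset.sum_le_card_nsmul (Finset.range n)
          (fun j : ℕ => Real.log (A + |(j : ℝ) + 1|)) (Real.log (A + n)) fun j hj => by
            have : (j : ℝ) + 1 ≤ n := by exact_mod_cast Finset.mem_range.1 hj
            refine Real.log_le_log (hg _) ?_
            rw [abs_of_nonneg (by positivity)]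
            linarith
        simpa using this
    exact haux.trans (mul_le_mul_of_nonneg_right (by linarith) (hlog0 _))

/-! ### Uniform embeddings of finite spaces. -/

/-- Finite metric spaces with a common packing bound have uniform almost bi-Lipschitz embeddings. -/
theorem exists_uniform_embedding_of_finite {α β M s δ : ℝ} (hα : 0 ≤ α) (hβ : 0 ≤ β) (hM : 0 < M)
    (hδ : 1 + (α + β) / 2 < δ) :
    ∃ (G N : ℕ) (C : ℝ), 0 < C ∧ ∀ (Y : Type u) [MetricSpace Y] [Fintype Y],
      PackingBound Y α β M s → ∃ L : Y → Fin G → Fin N → ℝ,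
        ∀ x y, ‖L x - L y‖ ≤ C * dist x y ∧
          (x ≠ y → dist x y / slog (dist x y) ^ δ ≤ C * ‖L x - L y‖) := by
  obtain ⟨η, hη, hηδ⟩ : ∃ η : ℝ, 0 < η ∧
      (1 + η) + ((1 + 2 * η) * (α + β) + η) / 2 + 3 * η ≤ δ := by
    -- The terms in `η` add up to `η (α + β + 9 / 2)`, so this `η` fits in the gap.
    refine ⟨(δ - (1 + (α + β) / 2)) / (α + β + 5), by
      have : 0 < δ - (1 + (α + β) / 2) := by linarith
      positivity, ?_⟩
    set η := (δ - (1 + (α + β) / 2)) / (α + β + 5) with h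
    have h1 : η * (α + β + 5) = δ - (1 + (α + β) / 2) := div_mul_cancel₀ _ (by positivity)
    have h2 : 0 < η := div_pos (by linarith) (by positivity)
    nlinarith
  have hδ0 : 0 < δ := by nlinarith
  have hsum := summable_one_add_abs_int_rpow (show 1 < 1 + η by linarith)
  set Λ := ∑' i : ℤ, (1 + |(i : ℝ)|) ^ (-(1 + η)) with hΛ_def
  have hΛ0 : 0 ≤ Λ := tsum_nonneg fun i => by positivity
  obtain ⟨N, hN⟩ := exists_separating_perturbation.{u} (s := s) hα hβ hM hη hΛ0 hηδ
  set G := ⌈(δ + 1) / η⌉₊ with hG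
  have hGη : δ + 1 ≤ η * G := by
    have := Nat.le_ceil ((δ + 1) / η)
    rw [div_le_iff₀ hη] at this
    rw [mul_comm]
    exact this
  have hG0 : 0 < G := Nat.ceil_pos.2 (by positivity)
  obtain ⟨A, hA⟩ := Filter.eventually_atTop.1 (hN.and ((Filter.eventually_ge_atTop (2 * G : ℝ)).and
    ((Filter.eventually_ge_atTop (Real.exp (1 / η))).and
      (Filter.eventually_ge_atTop (Λ * 2 ^ (η * G))))))
  obtain ⟨-, hA2G, hAexp, -⟩ := hA A le_rfl
  have hA1 : 1 ≤ A := by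
    have : (1 : ℝ) ≤ G := by exact_mod_cast hG0
    linarith
  have hAη : 1 ≤ η * Real.log A := by
    have := (Real.le_log_iff_exp_le (by linarith)).2 hAexp
    rw [div_le_iff₀ hη] at this
    linarith
  obtain ⟨r, hr0, hrsucc, hrlog, hrup, hrdown⟩ := exists_scales hη hA1 hAη
  let g : ℤ → ℝ := fun i => A + |(i : ℝ)|
  have hgA : ∀ i, A ≤ g i := fun i => by
    have := abs_nonneg (i : ℝ)
    simp only [g]; linarith
  have hg1 : ∀ i, 1 ≤ g i := fun i => hA1.trans (hgA i)
  have hg0 : ∀ i, 0 < g i := fun i => zero_lt_one.trans_le (hg1 i)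
  have hranti : Antitone r := antitone_int_of_succ_le fun i => by
    rw [hrsucc]
    exact mul_le_of_le_one_right (hr0 i).le
      (Real.rpow_le_one_of_one_le_of_nonpos (hg1 i) (by linarith))
  -- Within `G` steps `g` loses at most half, as `A ≥ 2 G`. Hence `G` ratios multiply to at most `2
  -- ^ (η G) * g ^ (-δ - 1)`, and the spare factor `1 / g` absorbs `Λ * 2 ^ (η G)`.
  have htail : ∀ i, Λ * r (i + G) ≤ r i * g i ^ (-δ) := by
    intro i
    have hstep : ∀ n : ℕ, n ≤ G → r (i + n) ≤ r i * ((g i / 2) ^ (-η)) ^ n := by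
      intro n
      induction n with
      | zero => simp
      | succ n ih =>
        intro hn
        have h1 := ih (by omega)
        have hn' : ((n : ℝ) + 1) ≤ G := by exact_mod_cast hn
        have h2 : g i / 2 ≤ A + |((i + n : ℤ) : ℝ)| := by
          have h3 : |(i : ℝ)| ≤ |((i + n : ℤ) : ℝ)| + n := by
            have := abs_sub ((i + n : ℤ) : ℝ) (n : ℝ)
            rw [Nat.abs_cast] at this
            refine le_trans (le_of_eq ?_) this
            push_cast; ring_nf
          have := abs_nonneg ((i + n : ℤ) : ℝ)
          simp only [g]
          linarith
        have h3 : (A + |((i + n : ℤ) : ℝ)|) ^ (-η) ≤ (g i / 2) ^ (-η) :=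
          Real.rpow_le_rpow_of_nonpos (by have := hg0 i; positivity) h2 (by linarith)
        have h4 : 0 ≤ (A + |((i + n : ℤ) : ℝ)|) ^ (-η) := by positivity
        have h5 := (hr0 (i + n)).le
        rw [Nat.cast_succ, ← add_assoc, hrsucc, pow_succ, ← mul_assoc]
        exact mul_le_mul h1 h3 h4 (h5.trans h1)
    have h1 := hstep G le_rfl
    have hgi := hg0 i
    have h2 : ((g i / 2) ^ (-η)) ^ G = 2 ^ (η * G) * g i ^ (-(η * G)) := by
      rw [← Real.rpow_natCast, ← Real.rpow_mul (by positivity),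
        Real.div_rpow hgi.le zero_le_two, neg_mul, Real.rpow_neg zero_le_two]
      field_simp
    have h3 : g i ^ (-(η * G)) ≤ g i ^ (-δ - 1) :=
      Real.rpow_le_rpow_of_exponent_le (hg1 i) (by linarith)
    rw [Real.rpow_sub_one hgi.ne'] at h3
    have h4 := (hA (g i) (hgA i)).2.2.2
    calc Λ * r (i + G) ≤ Λ * (r i * (2 ^ (η * G) * (g i ^ (-δ) / g i))) := by
          rw [h2] at h1
          have := (hr0 i).le
          exact mul_le_mul_of_nonneg_left (h1.trans (by gcongr)) hΛ0
      _ = r i * (g i ^ (-δ) / g i) * (Λ * 2 ^ (η * G)) := by ring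
      _ ≤ r i * (g i ^ (-δ) / g i) * g i := by
          have := (hr0 i).le
          gcongr
      _ = _ := by field_simp
  have hscale : ∀ d : ℝ, 0 < d → ∃ i : ℤ, r (i + 1) < d ∧ d ≤ r i := by
    intro d hd
    obtain ⟨i, hi, himax⟩ := Int.exists_greatest_of_bdd (P := fun z => d ≤ r z)
      ⟨⌈|Real.log d|⌉, fun z hz => by
        rcases le_total z 0 with h | h
        · exact h.trans (Int.ceil_nonneg (abs_nonneg _))
        · have h1 := Real.log_le_log hd hz
          have h2 := hrup z h
          have h3 : (z : ℝ) ≤ ⌈|Real.log d|⌉ :=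
            le_trans (by linarith [neg_le_abs (Real.log d)]) (Int.le_ceil _)
          exact_mod_cast h3⟩
      ⟨-⌈|Real.log d|⌉, by
        have h := hrdown (-⌈|Real.log d|⌉)
          (neg_nonpos.2 (Int.ceil_nonneg (abs_nonneg _)))
        rw [← Real.log_le_log_iff hd (hr0 _)]
        push_cast at h
        linarith [le_abs_self (Real.log d), Int.le_ceil |Real.log d|]⟩
    refine ⟨i, ?_, hi⟩
    by_contra! h
    have := himax _ h
    omega
  have hgslog : ∀ d i, 0 < d → r (i + 1) < d → d ≤ r i →
      g i ≤ ((A + 1) / Real.log 2 + 1) * slog d := by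
    intro d i hd h1 h2
    have hi : |(i : ℝ)| ≤ 1 + |Real.log d| := by
      rcases le_or_gt 0 i with h | h
      · have h3 := hrup i h
        have h4 := Real.log_le_log hd h2
        rw [abs_of_nonneg (by exact_mod_cast h)]
        linarith [neg_le_abs (Real.log d)]
      · have h3 := hrdown (i + 1) (by omega)
        have h4 := Real.log_le_log (hr0 _) h1.le
        rw [abs_of_neg (by exact_mod_cast h)]
        push_cast at h3
        linarith [le_abs_self (Real.log d)]
    have h5 := log_two_le_slog hd
    have h6 := abs_log_le_slog hd
    have h7 : A + 1 ≤ (A + 1) / Real.log 2 * slog d := by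
      rw [div_mul_eq_mul_div, le_div_iff₀ (Real.log_pos one_lt_two)]
      exact mul_le_mul_of_nonneg_left h5 (by linarith)
    simp only [g]
    linarith
  set K := (A + 1) / Real.log 2 + 1 with hK
  have hK0 : 0 < K := by
    have := Real.log_pos one_lt_two
    positivity
  have hKδ : 0 < K ^ δ := Real.rpow_pos_of_pos hK0 _
  refine ⟨G, N, Λ + K ^ δ, by linarith, fun Y _ _ hY => ?_⟩
  have hchoice : ∀ e : Y × Y, ∃ i : ℤ, e.1 ≠ e.2 → r (i + 1) < dist e.1 e.2 ∧ dist e.1 e.2 ≤ r i := by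
    intro e
    by_cases h : e.1 = e.2
    · exact ⟨0, fun h' => absurd h h'⟩
    · obtain ⟨i, hi⟩ := hscale _ (dist_pos.2 h)
      exact ⟨i, fun _ => hi⟩
  choose idx hidx using hchoice
  -- Finiteness of `Y` bounds the scale indices that occur, so the construction can begin at a
  -- coarsest scale; no constant depends on `I`.
  set I := Finset.univ.sup fun e => (idx e).natAbs with hI
  have hidxI : ∀ e, (idx e).natAbs ≤ I := fun e =>
    Finset.le_sup (f := fun e => (idx e).natAbs) (Finset.mem_univ e)
  have hgroup : ∀ e : Fin G, ∃ L : Y → Fin N → ℝ, (∀ x y, ‖L x - L y‖ ≤ Λ * dist x y) ∧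
      ∀ j < 2 * I + 1, ∀ x y, r ((e : ℤ) + G * ((j : ℤ) - I) + 1) < dist x y →
        dist x y ≤ r ((e : ℤ) + G * ((j : ℤ) - I)) →
        r ((e : ℤ) + G * ((j : ℤ) - I)) * g ((e : ℤ) + G * ((j : ℤ) - I)) ^ (-δ) ≤
          ‖L x - L y‖ := by
    intro e
    let ix : ℕ → ℤ := fun j => (e : ℤ) + G * ((j : ℤ) - I)
    have hGz : (0 : ℤ) < G := by exact_mod_cast hG0
    have hix : Function.Injective ix := fun j j' h => by
      have h' : (G : ℤ) * ((j : ℤ) - I) = G * ((j' : ℤ) - I) := by simpa [ix] using h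
      have := mul_left_cancel₀ hGz.ne' h'
      omega
    have hixsucc : ∀ j, ix (j + 1) = ix j + G := fun j => by
      simp only [ix]; push_cast; ring
    refine exists_sum_perturbations (fun j => g (ix j) ^ (-(1 + η))) (fun j => r (ix j))
      (fun j => r (ix j + 1)) (fun j => r (ix j) * g (ix j) ^ (-δ))
      (fun j => (Real.rpow_pos_of_pos (hg0 _) _).le) (fun j => (hr0 _).le)
      (antitone_nat_of_succ_le fun j => hranti (by rw [hixsucc]; omega)) (fun J => ?_)
      (fun j c hc => ?_) (fun j => ?_) _
    · calc ∑ j ∈ Finset.range J, g (ix j) ^ (-(1 + η))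
          ≤ ∑ j ∈ Finset.range J, (1 + |(ix j : ℝ)|) ^ (-(1 + η)) :=
            Finset.sum_le_sum fun j _ => Real.rpow_le_rpow_of_nonpos (by positivity)
              (by simp only [g]; linarith) (by linarith)
        _ = ∑ i ∈ (Finset.range J).map ⟨ix, hix⟩, (1 + |(i : ℝ)|) ^ (-(1 + η)) := by
            rw [Finset.sum_map]; rfl
        _ ≤ Λ := hsum.sum_le_tsum _ fun i _ => by positivity
    · obtain ⟨ψ, h1, h2, h3⟩ := (hA (g (ix j)) (hgA _)).1 (r (ix j)) (hr0 _) (hrlog _) Y hY c hc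
      refine ⟨ψ, h1, h2, fun x y hlo hhi => h3 x y ?_ hhi⟩
      rwa [hrsucc] at hlo
    · rw [hixsucc]
      exact htail _
  choose L hL1 hL2 using hgroup
  refine ⟨fun x e => L e x, fun x y => ⟨?_, fun hxy => ?_⟩⟩
  · refine (pi_norm_le_iff_of_nonneg (by positivity)).2 fun e => (hL1 e x y).trans ?_
    exact mul_le_mul_of_nonneg_right (by linarith) dist_nonneg
  · have hd := dist_pos.2 hxy
    obtain ⟨h1, h2⟩ := hidx (x, y) hxy
    simp only at h1 h2
    set i := idx (x, y) with hi
    have hGz : (0 : ℤ) < G := by exact_mod_cast hG0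
    have he0 := Int.emod_nonneg i hGz.ne'
    have he1 := Int.emod_lt_of_pos i hGz
    have hiI := hidxI (x, y)
    have hu1 : -(I : ℤ) ≤ i / G := by
      rw [Int.le_ediv_iff_mul_le hGz]
      have : (I : ℤ) ≤ I * G := by nlinarith
      have : -(I : ℤ) ≤ i := by omega
      linarith
    have hu2 : i / G ≤ I := by
      refine Int.le_of_lt_add_one ((Int.ediv_lt_iff_lt_mul hGz).2 ?_)
      have : i ≤ I := by omega
      nlinarith
    -- The residue of `i` mod `G` selects the block of coordinates, and the quotient shifted by `I`
    -- selects the stage in that block.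
    have hieq : ((⟨(i % G).toNat, by omega⟩ : Fin G) : ℤ) +
        G * ((((i / G + I).toNat : ℕ) : ℤ) - I) = i := by
      have := Int.emod_add_mul_ediv i G
      rw [Int.toNat_of_nonneg (show 0 ≤ i / G + I by linarith)]
      simp only [Int.toNat_of_nonneg he0]
      linarith
    have h3 := hL2 ⟨(i % G).toNat, by omega⟩ (i / G + I).toNat (by omega) x y
    rw [hieq] at h3
    have h4 := (h3 h1 h2).trans (norm_le_pi_norm (fun e => L e x - L e y) _)
    have hs := slog_pos hd
    have h5 : 1 / slog (dist x y) ^ δ ≤ K ^ δ * g i ^ (-δ) := by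
      have hgi := hg0 i
      have := Real.rpow_le_rpow hgi.le (hgslog _ i hd h1 h2) hδ0.le
      rw [Real.mul_rpow hK0.le hs.le] at this
      have hsδ := Real.rpow_pos_of_pos hs δ
      have hgδ := Real.rpow_pos_of_pos hgi δ
      rw [Real.rpow_neg hgi.le, ← div_eq_mul_inv, div_le_div_iff₀ hsδ hgδ]
      linarith
    have hgδ := Real.rpow_pos_of_pos (hg0 i) (-δ)
    calc dist x y / slog (dist x y) ^ δ = dist x y * (1 / slog (dist x y) ^ δ) := by ring
      _ ≤ r i * (K ^ δ * g i ^ (-δ)) := mul_le_mul h2 h5 (by positivity) (hr0 i).le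
      _ = K ^ δ * (r i * g i ^ (-δ)) := by ring
      _ ≤ K ^ δ * ‖fun e => L e x - L e y‖ := mul_le_mul_of_nonneg_left h4 hKδ.le
      _ ≤ _ := mul_le_mul_of_nonneg_right (by linarith) (norm_nonneg _)

/-! ### From coverings to packings, and from finite subsets to the whole space. -/

/-- Subtracting `Φ(x)` carries the ball about any `x` isometrically into the ball about `0` of the
difference set; a covering ball of radius `ρ` holds at most one point of a set with separation above
`2 ρ`. -/
theorem packingBound_of_almostHomogeneousAtZeroWith {X : Type*} [MetricSpace X] {α β M s : ℝ}
    (h : AlmostHomogeneousAtZeroWith α β M s (kuratowskiDiff X)) : PackingBound X α β M s := by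
  classical
  intro x R ρ hρ hR S hS hsep
  obtain ⟨T, -, hcover, hcard⟩ := h R ρ hρ hR
  refine le_trans ?_ hcard
  choose f hf hfcoe hfnorm using fun p => kuratowskiMap_sub_mem p x
  have hnear : ∀ p, ∃ z, p ∈ S → z ∈ T ∧ dist (f p) z ≤ ρ := fun p => by
    by_cases hp : p ∈ S
    · have hmem : f p ∈ Metric.closedBall 0 R ∩ kuratowskiDiff X :=
        ⟨by rw [mem_closedBall_zero_iff, hfnorm]; exact hS p hp, hf p⟩
      obtain ⟨z, hz, hpz⟩ := Set.mem_iUnion₂.1 (hcover hmem)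
      exact ⟨z, fun _ => ⟨hz, hpz⟩⟩
    · exact ⟨0, fun hp' => absurd hp' hp⟩
  choose z hz using hnear
  refine Nat.cast_le.2 (Finset.card_le_card_of_injOn z (fun p hp => (hz p hp).1) ?_)
  intro p hp q hq hpq
  by_contra hne
  have h1 := (hz p hp).2
  have h2 := (hz q hq).2
  rw [← hpq] at h2
  have h3 : dist p q ≤ dist (f p) (f q) := by
    rw [dist_eq_norm]
    have h4 := lp.norm_apply_le_norm ENNReal.top_ne_zero (f p - f q) q
    have h5 : (f p - f q : LInfty X) q = dist p q := by
      rw [lp.coeFn_sub, hfcoe, hfcoe]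
      simp [kuratowskiMap]
    rw [h5, Real.norm_of_nonneg dist_nonneg] at h4
    exact h4
  have h6 := dist_triangle_right (f p) (f q) (z p)
  have h7 := hsep p hp q hq hne
  linarith

theorem PackingBound.subtype {X : Type*} [MetricSpace X] {α β M s : ℝ}
    (h : PackingBound X α β M s) (P : X → Prop) : PackingBound {x // P x} α β M s := by
  intro x R ρ hρ hR S hS hsep
  have := h x R ρ hρ hR (S.map (Function.Embedding.subtype P))
    (fun p hp => by
      obtain ⟨p', hp', rfl⟩ := Finset.mem_map.1 hp
      exact hS p' hp')
    (fun p hp q hq hpq => by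
      obtain ⟨p', hp', rfl⟩ := Finset.mem_map.1 hp
      obtain ⟨q', hq', rfl⟩ := Finset.mem_map.1 hq
      exact hsep p' hp' q' hq' fun h => hpq (by rw [h]))
  rwa [Finset.card_map] at this

/-- Uniform embeddings of the finite subsets have a limit on the whole space. -/
theorem exists_embedding_of_finite_subsets {X V : Type*} [MetricSpace X] [NormedAddCommGroup V]
    [ProperSpace V] {C : ℝ} (lo : X → X → ℝ)
    (h : ∀ F : Finset X, ∃ L : X → V, ∀ x ∈ F, ∀ y ∈ F,
      ‖L x - L y‖ ≤ C * dist x y ∧ (x ≠ y → lo x y ≤ C * ‖L x - L y‖)) :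
    ∃ L : X → V, ∀ x y, ‖L x - L y‖ ≤ C * dist x y ∧ (x ≠ y → lo x y ≤ C * ‖L x - L y‖) := by
  classical
  rcases isEmpty_or_nonempty X with hX | ⟨⟨x₀⟩⟩
  · exact ⟨0, fun x => hX.elim x⟩
  choose L hL using h
  -- Normalising at `x₀` confines the values at `x` to a ball of radius `C * dist x x₀`, which is
  -- compact.
  let L' : Finset X → X → V := fun F x => L F x - L F x₀
  let U : Ultrafilter (Finset X) := Ultrafilter.of Filter.atTop
  have hU : (U : Filter (Finset X)) ≤ Filter.atTop := Ultrafilter.of_le _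
  have hmem : ∀ x, ∀ᶠ F in (U : Filter (Finset X)), x ∈ F := fun x =>
    hU ((Filter.eventually_ge_atTop {x}).mono fun F hF => hF (Finset.mem_singleton_self x))
  have hlim : ∀ x, ∃ v, Filter.Tendsto (fun F => L' F x) U (nhds v) := by
    intro x
    obtain ⟨v, -, hv⟩ := (isCompact_closedBall (0 : V) (C * dist x x₀)).ultrafilter_le_nhds
      (U.map fun F => L' F x) (by
        rw [Filter.le_principal_iff]
        refine Filter.mem_map.2 ?_
        filter_upwards [hmem x, hmem x₀] with F h1 h2
        exact mem_closedBall_zero_iff.2 (hL F x h1 x₀ h2).1)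
    exact ⟨v, hv⟩
  choose M hM using hlim
  refine ⟨M, fun x y => ?_⟩
  have ht : Filter.Tendsto (fun F => ‖L' F x - L' F y‖) U (nhds ‖M x - M y‖) :=
    ((hM x).sub (hM y)).norm
  have hsub : ∀ F, L' F x - L' F y = L F x - L F y := fun F => sub_sub_sub_cancel_right _ _ _
  refine ⟨le_of_tendsto ht ?_, fun hxy => ge_of_tendsto (ht.const_mul C) ?_⟩
  · filter_upwards [hmem x, hmem y] with F h1 h2
    rw [hsub]
    exact (hL F x h1 y h2).1
  · filter_upwards [hmem x, hmem y] with F h1 h2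
    rw [hsub]
    exact (hL F x h1 y h2).2 hxy

theorem mainTheorem5 {X : Type*} [MetricSpace X] (α β : ℝ) (hα : 0 ≤ α) (hβ : 0 ≤ β)
    (hX : AlmostHomogeneousAtZero α β (kuratowskiDiff X))
    (δ : ℝ) (hδ : 1 + (α + β) / 2 < δ) :
    ∃ (N : ℕ) (L : X → EuclideanSpace ℝ (Fin N)),
      Function.Injective L ∧ BiLipschitzWithLogCorrection δ L := by
  classical
  obtain ⟨M, s, hM, -, hcov⟩ := hX
  have hpack := packingBound_of_almostHomogeneousAtZeroWith hcov
  obtain ⟨G, N, C, hC, hfin⟩ := exists_uniform_embedding_of_finite (s := s) hα hβ hM hδ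
  obtain ⟨L, hL⟩ := exists_embedding_of_finite_subsets (X := X) (V := Fin G → Fin N → ℝ) (C := C)
    (fun x y => dist x y / slog (dist x y) ^ δ) fun F => by
      obtain ⟨L, hL⟩ := hfin {x // x ∈ F} (hpack.subtype _)
      -- The value `0` off `F` is arbitrary, since only pairs inside `F` are compared.
      refine ⟨fun x => if hx : x ∈ F then L ⟨x, hx⟩ else 0, fun x hx y hy => ?_⟩
      have := hL ⟨x, hx⟩ ⟨y, hy⟩
      simpa only [dif_pos hx, dif_pos hy, Subtype.dist_eq, ne_eq, Subtype.mk.injEq] using this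
  let e := finProdFinEquiv (m := G) (n := N)
  let L' : X → EuclideanSpace ℝ (Fin (G * N)) := fun x =>
    WithLp.toLp 2 fun k => L x (e.symm k).1 (e.symm k).2
  have hup : ∀ x y, dist (L' x) (L' y) ≤ √(G * N : ℕ) * ‖L x - L y‖ := fun x y => by
    rw [EuclideanSpace.dist_eq]
    refine Real.sqrt_le_iff.2 ⟨by positivity, ?_⟩
    rw [mul_pow, Real.sq_sqrt (Nat.cast_nonneg _)]
    refine (Finset.sum_le_card_nsmul _ _ (‖L x - L y‖ ^ 2) fun k _ => ?_).trans (by simp)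
    refine pow_le_pow_left₀ dist_nonneg ?_ 2
    rw [dist_eq_norm]
    exact (norm_le_pi_norm ((L x - L y) (e.symm k).1) _).trans (norm_le_pi_norm (L x - L y) _)
  have hlow : ∀ x y, ‖L x - L y‖ ≤ dist (L' x) (L' y) := fun x y => by
    refine (pi_norm_le_iff_of_nonneg dist_nonneg).2 fun a =>
      (pi_norm_le_iff_of_nonneg dist_nonneg).2 fun b => ?_
    have := PiLp.norm_apply_le (L' x - L' y) (e (a, b))
    rw [dist_eq_norm]
    simpa [L'] using this
  -- Cost of replacing the sup norm on `G * N` coordinates by the Euclidean norm.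
  set c := √(G * N : ℕ) with hc
  have hc0 : 0 ≤ c := Real.sqrt_nonneg _
  refine ⟨G * N, L', fun x y hxy => ?_, C * (c + 1), by positivity, fun x y hxy => ⟨?_, ?_⟩⟩
  · by_contra hne
    have h1 := (hL x y).2 hne
    have h2 := hlow x y
    rw [hxy, dist_self] at h2
    have h3 := dist_pos.2 hne
    have h4 : 0 < dist x y / slog (dist x y) ^ δ :=
      div_pos h3 (Real.rpow_pos_of_pos (slog_pos h3) _)
    have h5 : C * ‖L x - L y‖ ≤ 0 := mul_nonpos_of_nonneg_of_nonpos hC.le h2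
    linarith
  · rw [one_div_mul_eq_div, div_le_iff₀ (by positivity)]
    have h1 := (hL x y).2 hxy
    have h2 := mul_le_mul_of_nonneg_left (hlow x y) hC.le
    have h3 : 0 ≤ C * c * dist (L' x) (L' y) := by positivity
    linarith
  · have h1 := hup x y
    have h2 := mul_le_mul_of_nonneg_left (hL x y).1 hc0
    have h3 : 0 ≤ C * dist x y := by positivity
    linarith
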